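/- Let $R$ be a commutative ring and $n$ a positive integer. Let $P=\mathrm{Par}(n)$ be the set of partitions of $n$, partially ordered by dominance ($\lambda\trianglelefteq\mu$ iff $\lambda_1+\dots+\lambda_k\le\mu_1+\dots+\mu_k$ for all $k$), and let $\mathrm{Sym}(n)$ be the group of permutations of $\{1,\dots,n\}$. For $\sigma\in\mathrm{Sym}(n)$ let $\mathrm{sh}(\sigma)\in P$ be the shape of the pair of standard tableaux that the Robinson--Schensted correspondence (by row insertion) assigns to the word $\sigma(1)\sigma(2)\cdots\sigma(n)$, and for $\Gamma\subseteq P$ put $G(\Gamma)=\{\sigma\in\mathrm{Sym}(n) : \mathrm{sh}(\sigma)\in\Gamma\}$; write $RG(\Gamma)$ for the $R$-span of $G(\Gamma)$ in the group algebra $R\,\mathrm{Sym}(n)$. For $\mu=(\mu_1,\dots,\mu_m)\in P$ with $\mu_1\ge\dots\ge\mu_m>0$ let $\mathrm{Sym}(\mu)=\mathrm{Sym}(X_1)\times\cdots\times\mathrm{Sym}(X_m)\le\mathrm{Sym}(n)$ be the Young subgroup, where $X_1=\{1,\dots,\mu_1\}$, $X_2=\{\mu_1+1,\dots,\mu_1+\mu_2\}$,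 and so on, and for $\Delta\subseteq P$ let $I_R(\Delta)$ be the two-sided ideal of $R\,\mathrm{Sym}(n)$ generated by the elements $\sum_{\sigma\in\mathrm{Sym}(\mu)}\sigma$, $\mu\in\Delta$. Let $\Delta\subseteq P$ be co-saturated, i.e. whenever $\mu\in\Delta$, $\lambda\in P$ and $\mu\trianglelefteq\lambda$, then $\lambda\in\Delta$. Suppose that $P\setminus\Delta$ has a unique maximal element with respect to dominance. Then $$R\,\mathrm{Sym}(n)=RG(P\setminus\Delta)+I_R(\Delta).$$ -/

import Mathlib

namespace SymGroupAlg

/-! ### Partitions and the dominance order -/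

/-- The parts of `p` listed in weakly decreasing order `p₁ ≥ p₂ ≥ ⋯`. -/
def sortedParts {n : ℕ} (p : n.Partition) : List ℕ := p.parts.sort (· ≥ ·)

/-- The sum `p₁ + ⋯ + p_k` of the `k` largest parts of `p` (all of them if there are fewer). -/
def partialSum {n : ℕ} (p : n.Partition) (k : ℕ) : ℕ := ((sortedParts p).take k).sum

theorem eq_of_take_sum_eq : ∀ (l₁ l₂ : List ℕ), (∀ x ∈ l₁, 0 < x) → (∀ x ∈ l₂, 0 < x) →
    (∀ k, (l₁.take k).sum = (l₂.take k).sum) → l₁ = l₂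
  | [], [], _, _, _ => rfl
  | [], b :: l₂, _, h₂, h => by
      have h1 := h 1
      have hb := h₂ b (by simp)
      simp at h1
      omega
  | a :: l₁, [], h₁, _, h => by
      have h1 := h 1
      have ha := h₁ a (by simp)
      simp at h1
      omega
  | a :: l₁, b :: l₂, h₁, h₂, h => by
      have hab : a = b := by simpa using h 1
      subst hab
      congr 1
      refine eq_of_take_sum_eq l₁ l₂ (fun x hx => h₁ x (by simp [hx]))
        (fun x hx => h₂ x (by simp [hx])) (fun k => ?_)
      simpa using h (k + 1)

/-- The dominance order: `p ≤ q` iff `p₁ + ⋯ + p_k ≤ q₁ + ⋯ + q_k` for all `k`. -/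
instance dominanceOrder (n : ℕ) : PartialOrder n.Partition where
  le p q := ∀ k, partialSum p k ≤ partialSum q k
  le_refl _ _ := le_rfl
  le_trans _ _ _ h₁ h₂ k := (h₁ k).trans (h₂ k)
  le_antisymm p q h₁ h₂ := by
    have h : sortedParts p = sortedParts q :=
      eq_of_take_sum_eq _ _ (fun x hx => p.parts_pos (by simpa [sortedParts] using hx))
        (fun x hx => q.parts_pos (by simpa [sortedParts] using hx))
        (fun k => le_antisymm (h₁ k) (h₂ k))
    have h' := congrArg (fun l : List ℕ => (l : Multiset ℕ)) h
    exact Nat.Partition.ext (by simpa [sortedParts] using h')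

/-! ### Robinson–Schensted row insertion -/

section RobinsonSchensted

variable {α : Type*} [LinearOrder α]

/-- Insert `x` into a row: `x` replaces (bumps) the leftmost entry larger than `x`, which is
returned as the second component; if there is none, `x` is put at the end of the row. -/
def rowInsert (x : α) : List α → List α × Option α
  | [] => ([x], none)
  | y :: ys => if x < y then (x :: ys, some y)
      else (y :: (rowInsert x ys).1, (rowInsert x ys).2)

/-- Insert `x` into a tableau given by its list of rows: the entry bumped from a row is inserted
into the next row. -/
def tableauInsert (x : α) : List (List α) → List (List α)
  | [] => [[x]]
  | r :: rs => match (rowInsert x r).2 with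
      | none => (rowInsert x r).1 :: rs
      | some y => (rowInsert x r).1 :: tableauInsert y rs

/-- The insertion tableau of a word: its letters are inserted from left to right into the empty
tableau. -/
def insertionTableau (w : List α) : List (List α) :=
  w.foldl (fun T x => tableauInsert x T) []

theorem rowInsert_length (x : α) (r : List α) :
    0 < (rowInsert x r).1.length ∧
      (rowInsert x r).1.length + (rowInsert x r).2.toList.length = r.length + 1 := by
  induction r with
  | nil => simp [rowInsert]
  | cons y ys ih =>
    by_cases h : x < y
    · simp [rowInsert, h]
    · simp only [rowInsert, h, if_false, List.length_cons]
      omega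

theorem tableauInsert_lengths (x : α) (T : List (List α)) (hT : ∀ r ∈ T, 0 < r.length) :
    (∀ r ∈ tableauInsert x T, 0 < r.length) ∧
      ((tableauInsert x T).map List.length).sum = (T.map List.length).sum + 1 := by
  induction T generalizing x with
  | nil => simp [tableauInsert]
  | cons r rs ih =>
    have hr := rowInsert_length x r
    have hrs : ∀ r ∈ rs, 0 < r.length := fun r' h' => hT r' (by simp [h'])
    rw [tableauInsert]
    cases hy : (rowInsert x r).2 with
    | none =>
      simp only [hy, Option.toList_none, List.length_nil] at hr
      simp only [List.mem_cons, forall_eq_or_imp, List.map_cons, List.sum_cons]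
      exact ⟨⟨hr.1, hrs⟩, by omega⟩
    | some y =>
      have h2 := ih y hrs
      simp only [hy, Option.toList_some, List.length_singleton] at hr
      simp only [List.mem_cons, forall_eq_or_imp, List.map_cons, List.sum_cons]
      exact ⟨⟨hr.1, h2.1⟩, by omega⟩

theorem insertionTableau_lengths (w : List α) :
    (∀ r ∈ insertionTableau w, 0 < r.length) ∧
      ((insertionTableau w).map List.length).sum = w.length := by
  induction w using List.reverseRecOn with
  | nil => simp [insertionTableau]
  | append_singleton w x ih =>
    have h := tableauInsert_lengths x _ ih.1
    have e : insertionTableau (w ++ [x]) = tableauInsert x (insertionTableau w) := by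
      simp [insertionTableau]
    rw [e, List.length_append, List.length_singleton, ← ih.2]
    exact h

end RobinsonSchensted

/-- The shape of a permutation `σ`: the partition formed by the row lengths of the insertion
tableau of the word `σ(1) σ(2) ⋯ σ(n)`. (The recording tableau has the same shape.) -/
def shape {n : ℕ} (σ : Equiv.Perm (Fin n)) : n.Partition where
  parts := ((insertionTableau (List.ofFn σ)).map List.length : List ℕ)
  parts_pos := by
    intro i hi
    obtain ⟨r, hr, rfl⟩ := List.mem_map.1 (Multiset.mem_coe.1 hi)
    exact (insertionTableau_lengths (List.ofFn σ)).1 r hr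
  parts_sum := by
    simpa using (insertionTableau_lengths (List.ofFn σ)).2

/-- The set `G(Γ)` of permutations whose shape lies in `Γ`. -/
def permsOfShape {n : ℕ} (Γ : Set n.Partition) : Set (Equiv.Perm (Fin n)) :=
  {σ | shape σ ∈ Γ}

/-! ### Young subgroups and the ideals they generate -/

/-- The `r`-th (counting from `0`) of the consecutive blocks of sizes `μ₁, μ₂, …` into which
`Fin n` is cut by `μ`; it is empty if `μ` has at most `r` parts. -/
def block {n : ℕ} (μ : n.Partition) (r : ℕ) : Set (Fin n) :=
  {i | partialSum μ r ≤ (i : ℕ) ∧ (i : ℕ) < partialSum μ (r + 1)}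

open scoped Pointwise in
/-- The Young subgroup `Sym(μ) = Sym(X₁) × Sym(X₂) × ⋯`: the permutations that map every block
of `μ` onto itself. -/
def youngSubgroup {n : ℕ} (μ : n.Partition) : Subgroup (Equiv.Perm (Fin n)) :=
  ⨅ r, MulAction.stabilizer (Equiv.Perm (Fin n)) (block μ r)

open Classical in
/-- The element `[H] = ∑_{h ∈ H} h` of the group algebra. -/
noncomputable def setSum (R : Type*) [CommRing R] {G : Type*} [Group G] [Fintype G]
    (H : Set G) : MonoidAlgebra R G :=
  ∑ h : G with h ∈ H, MonoidAlgebra.of R G h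

/-- The two-sided ideal `I_R(Δ)` generated by the elements `[Sym(μ)]`, `μ ∈ Δ`. -/
noncomputable def youngIdeal (R : Type*) [CommRing R] {n : ℕ} (Δ : Set n.Partition) :
    TwoSidedIdeal (MonoidAlgebra R (Equiv.Perm (Fin n))) :=
  TwoSidedIdeal.span
    ((fun μ : n.Partition => setSum R (youngSubgroup μ : Set (Equiv.Perm (Fin n)))) '' Δ)

/-- The `R`-span `R H` in the group algebra of a set `H` of group elements. -/
noncomputable def setSpan (R : Type*) [CommRing R] {G : Type*} [Group G] (H : Set G) :
    Submodule R (MonoidAlgebra R G) :=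
  Submodule.span R (MonoidAlgebra.of R G '' H)

end SymGroupAlg

/-! Every permutation is rewritten modulo the ideal, by downward induction on its word in
lexicographic order. Let `lam` be the maximal element of the complement of `Δ`. By finiteness every
partition not dominated by `lam` lies in `Δ`, so it suffices to produce a Young subgroup whose type
is not dominated by `lam`.

If `shape σ ∈ Δ`, then `shape σ` is not dominated by `lam`, so some `k` satisfies `partialSum lam k
< partialSum (shape σ) k`. The easy half of Greene's theorem (`exists_hasMonotoneSubwords_shape`)
gives at most `k` disjoint increasing subwords of `σ` of total length `partialSum (shape σ) k`. Let
`H` be the group permuting positions within each subword and fixing all others. It is conjugate to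
`Sym(μ)` with `μ` not dominated by `lam`, so `[H]` lies in the ideal. Since `σ` increases along each
subword, it is the lexicographically least element of `σH`, and `σ[H]` expresses `σ` through larger
permutations modulo the ideal.

For Greene's inequality, the rows of the insertion tableau are increasing subwords of its reading
word. Undoing the insertions by Knuth moves turns this word into `σ`, and each move preserves the
total length of the subwords. -/

namespace SymGroupAlg

/-! ### Knuth moves and monotone subwords -/

section Greene

variable {α : Type*} {ι : Type*}

/-- The row reading word of a tableau: its rows from the last to the first. -/
def readingWord (T : List (List α)) : List α := T.reverse.flatten

theorem readingWord_cons (r : List α) (T : List (List α)) :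
    readingWord (r :: T) = readingWord T ++ r := by
  simp [readingWord]

variable [LinearOrder α]

/-- The coloured letters (those whose second component is not `none`) of each colour form a weakly
increasing subword. -/
def IsMonotoneColoring (L : List (α × Option ι)) : Prop :=
  L.Pairwise fun a b => ∀ c, a.2 = some c → b.2 = some c → a.1 ≤ b.1

/-- The word `w` contains disjoint weakly increasing subwords, indexed by `ι`, of total length
`s`. -/
def HasMonotoneSubwords (ι : Type*) (s : ℕ) (w : List α) : Prop :=
  ∃ L : List (α × Option ι), L.map Prod.fst = w ∧ IsMonotoneColoring L ∧
    L.countP (fun a => a.2.isSome) = s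

/-- Sorting a descent cannot spoil a weakly increasing subword, so every letter keeps its colour. -/
theorem HasMonotoneSubwords.sort_adjacent {s : ℕ} {A B : List α} {u y : α} (huy : u < y)
    (h : HasMonotoneSubwords ι s (A ++ y :: u :: B)) :
    HasMonotoneSubwords ι s (A ++ u :: y :: B) := by
  obtain ⟨L, hw, hL, hs⟩ := h
  obtain ⟨LA, Ly, rfl, rfl, hLy⟩ := List.map_eq_append_iff.1 hw
  obtain ⟨⟨y, cy⟩, Lx, rfl, rfl, hLx⟩ := List.map_eq_cons_iff.1 hLy
  obtain ⟨⟨u, cu⟩, LB, rfl, rfl, rfl⟩ := List.map_eq_cons_iff.1 hLx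
  refine ⟨LA ++ (u, cu) :: (y, cy) :: LB, by simp, ?_, ?_⟩
  · simp only [IsMonotoneColoring, List.pairwise_append, List.pairwise_cons, List.mem_cons,
      forall_eq_or_imp] at hL ⊢
    obtain ⟨h1, ⟨⟨h2, h3⟩, h4, h5⟩, h6⟩ := hL
    refine ⟨h1, ⟨⟨fun _ _ _ => huy.le, h4⟩, h3, h5⟩, fun a ha => ?_⟩
    exact ⟨(h6 a ha).2.1, (h6 a ha).1, (h6 a ha).2.2⟩
  · rw [← hs]
    simp only [List.countP_append, List.countP_cons]
    omega

/-- This Knuth move creates a descent, which matters only if `x` and `v` share a colour. In that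
case `y` takes over the role of `x` in front of `v`, which is possible because `x < y ≤ v`. -/
theorem HasMonotoneSubwords.move_right_of_mid {s : ℕ} {A B : List α} {x y v : α} (hxy : x < y)
    (hyv : y ≤ v) (h : HasMonotoneSubwords ι s (A ++ y :: x :: v :: B)) :
    HasMonotoneSubwords ι s (A ++ y :: v :: x :: B) := by
  classical
  obtain ⟨L, hw, hL, hs⟩ := h
  obtain ⟨LA, Ly, rfl, rfl, hLy⟩ := List.map_eq_append_iff.1 hw
  obtain ⟨⟨y, cy⟩, Lx, rfl, rfl, hLx⟩ := List.map_eq_cons_iff.1 hLy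
  obtain ⟨⟨x, cx⟩, Lv, rfl, rfl, hLv⟩ := List.map_eq_cons_iff.1 hLx
  obtain ⟨⟨v, cv⟩, LB, rfl, rfl, rfl⟩ := List.map_eq_cons_iff.1 hLv
  simp only [IsMonotoneColoring, List.pairwise_append, List.pairwise_cons, List.mem_cons,
      forall_eq_or_imp] at hL
  obtain ⟨hA, ⟨⟨hyx, -, hyB⟩, ⟨hxv, hxB⟩, hvB, hB⟩, hAB⟩ := hL
  dsimp only at hxy hyv hyx hyB hxv hxB hvB hAB
  by_cases hc : ∃ c, cx = some c ∧ cv = some c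
  · obtain ⟨c, rfl, rfl⟩ := hc
    cases cy with
    | none =>
      -- `y` was free: it replaces `x` in the subword of colour `c`.
      refine ⟨LA ++ (y, some c) :: (v, some c) :: (x, none) :: LB, by simp, ?_, ?_⟩
      · simp only [IsMonotoneColoring, List.pairwise_append, List.pairwise_cons, List.mem_cons,
          forall_eq_or_imp]
        refine ⟨hA, ⟨⟨fun _ _ _ => hyv, by simp, fun b hb d h1 h2 => ?_⟩,
          ⟨by simp, hvB⟩, by simp, hB⟩, fun a ha => ⟨fun d h1 h2 => ?_, (hAB a ha).2.2.1, by simp,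
            (hAB a ha).2.2.2⟩⟩
        · exact hyv.trans (hvB b hb d h1 h2)
        · exact ((hAB a ha).2.1 d h1 h2).trans hxy.le
      · rw [← hs]
        simp only [List.countP_append, List.countP_cons]
        simp
    | some e =>
      have hec : e ≠ c := by
        rintro rfl
        exact absurd (hyx e rfl rfl) (not_le.2 hxy)
      have key : ∀ (o : Option ι) (d : ι), (Equiv.swap (some c) (some e)) o = some d ↔
          o = some (Equiv.swap c e d) := by
        intro o d
        rw [Equiv.swap_apply_eq_iff]
        simp only [Equiv.swap_apply_def, Option.some.injEq]
        split_ifs <;> rfl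
      -- The two subwords exchange tails: `v` and what followed it in colour `c` now continue `y`,
      -- while what followed `y` in colour `e` now continues `x`.
      refine ⟨LA ++ (y, some e) :: (v, some e) :: (x, some c) ::
        LB.map (Prod.map id (Equiv.swap (some c) (some e))), by simp, ?_, ?_⟩
      · simp only [IsMonotoneColoring, List.pairwise_append, List.pairwise_cons, List.mem_cons,
          forall_eq_or_imp, List.forall_mem_map, List.pairwise_map, Prod.map_fst, Prod.map_snd, key,
          id, Option.some.injEq]
        refine ⟨hA, ⟨⟨fun _ _ _ => hyv, ?_, ?_⟩, ⟨?_, ?_⟩, ?_, ?_⟩, fun a ha => ⟨?_, ?_, ?_, ?_⟩⟩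
        · rintro d rfl rfl
          exact absurd rfl hec
        · rintro b hb _ rfl h
          rw [Equiv.swap_apply_right] at h
          exact hyv.trans (hvB b hb c rfl h)
        · rintro d rfl rfl
          exact absurd rfl hec
        · rintro b hb _ rfl h
          rw [Equiv.swap_apply_right] at h
          exact hvB b hb c rfl h
        · rintro b hb _ rfl h
          rw [Equiv.swap_apply_left] at h
          exact hxy.le.trans (hyB b hb e rfl h)
        · exact hB.imp fun h d => h _
        · rintro _ h rfl
          exact (hAB a ha).1 _ h rfl
        · rintro _ h rfl
          exact ((hAB a ha).1 _ h rfl).trans hyv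
        · rintro _ h rfl
          exact (hAB a ha).2.1 _ h rfl
        · intro b hb d h1 h2
          by_cases hdc : d = c
          · subst hdc
            rw [Equiv.swap_apply_left] at h2
            exact ((hAB a ha).2.1 _ h1 rfl).trans (hxy.le.trans (hyB b hb e rfl h2))
          by_cases hde : d = e
          · subst hde
            rw [Equiv.swap_apply_right] at h2
            exact ((hAB a ha).1 _ h1 rfl).trans (hyv.trans (hvB b hb c rfl h2))
          rw [Equiv.swap_apply_of_ne_of_ne hdc hde] at h2
          exact (hAB a ha).2.2.2 b hb d h1 h2
      · rw [← hs]
        simp only [List.countP_append, List.countP_cons, List.countP_map, Option.isSome_some]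
        congr 4
        refine List.countP_congr fun a _ => ?_
        simp only [Function.comp, Prod.map_snd, Equiv.swap_apply_def]
        split_ifs <;> simp_all
  · refine ⟨LA ++ (y, cy) :: (v, cv) :: (x, cx) :: LB, by simp, ?_, ?_⟩
    · simp only [IsMonotoneColoring, List.pairwise_append, List.pairwise_cons, List.mem_cons,
        forall_eq_or_imp]
      refine ⟨hA, ⟨⟨fun _ _ _ => hyv, hyx, hyB⟩, ⟨fun c h1 h2 => absurd ⟨c, h2, h1⟩ hc, hvB⟩,
        hxB, hB⟩, fun a ha => ⟨(hAB a ha).1, (hAB a ha).2.2.1, (hAB a ha).2.1, (hAB a ha).2.2.2⟩⟩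
    · rw [← hs]
      simp only [List.countP_append, List.countP_cons]
      omega

theorem HasMonotoneSubwords.move_left_past {s : ℕ} {B : List α} {y : α} (u : List α) :
    ∀ {A : List α}, (∀ a ∈ u, a < y) → HasMonotoneSubwords ι s (A ++ y :: (u ++ B)) →
      HasMonotoneSubwords ι s (A ++ u ++ y :: B) := by
  induction u with
  | nil => intro A _ h; simpa using h
  | cons a u ih =>
    intro A hu h
    have h1 : HasMonotoneSubwords ι s ((A ++ [a]) ++ y :: (u ++ B)) := by
      simpa using h.sort_adjacent (hu a (by simp))
    simpa using ih (fun b hb => hu b (by simp [hb])) h1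

theorem HasMonotoneSubwords.move_right_past {s : ℕ} {B : List α} {x : α} (v : List α) :
    ∀ {A : List α} {y : α}, x < y → (y :: v).Pairwise (· ≤ ·) →
      HasMonotoneSubwords ι s (A ++ y :: x :: (v ++ B)) →
      HasMonotoneSubwords ι s (A ++ y :: (v ++ x :: B)) := by
  induction v with
  | nil => intro A y _ _ h; simpa using h
  | cons a v ih =>
    intro A y hxy hv h
    have hya : y ≤ a := (List.pairwise_cons.1 hv).1 a (by simp)
    have h1 : HasMonotoneSubwords ι s ((A ++ [y]) ++ a :: x :: (v ++ B)) := by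
      simpa using HasMonotoneSubwords.move_right_of_mid hxy hya h
    simpa using ih (hxy.trans_le hya) (List.pairwise_cons.1 hv).2 h1

theorem rowInsert_cases (x : α) (r : List α) :
    (rowInsert x r = (r ++ [x], none) ∧ ∀ a ∈ r, a ≤ x) ∨
      ∃ u y v, r = u ++ y :: v ∧ (∀ a ∈ u, a ≤ x) ∧ x < y ∧
        rowInsert x r = (u ++ x :: v, some y) := by
  induction r with
  | nil => simp [rowInsert]
  | cons z r ih =>
    by_cases h : x < z
    · exact Or.inr ⟨[], z, r, by simp [rowInsert, h]⟩
    · rcases ih with ⟨h1, h2⟩ | ⟨u, y, v, h1, h2, h3, h4⟩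
      · left
        simp [rowInsert, h, h1, not_lt.1 h]
        exact h2
      · right
        refine ⟨z :: u, y, v, by simp [h1], ?_, h3, by simp [rowInsert, h, h4]⟩
        simpa [not_lt.1 h] using h2

theorem rowInsert_pairwise_le {x : α} {r : List α} (hr : r.Pairwise (· ≤ ·)) :
    (rowInsert x r).1.Pairwise (· ≤ ·) := by
  rcases rowInsert_cases x r with ⟨h1, h2⟩ | ⟨u, y, v, rfl, h2, h3, h4⟩
  · rw [h1]
    simpa [List.pairwise_append, hr] using h2
  · rw [h4]
    simp only [List.pairwise_append, List.pairwise_cons, List.mem_cons, forall_eq_or_imp] at hr ⊢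
    exact ⟨hr.1, ⟨fun b hb => h3.le.trans (hr.2.1.1 b hb), hr.2.1.2⟩,
      fun a ha => ⟨h2 a ha, (hr.2.2 a ha).2⟩⟩

theorem tableauInsert_pairwise_le {T : List (List α)} :
    ∀ {x : α}, (∀ r ∈ T, r.Pairwise (· ≤ ·)) → ∀ r ∈ tableauInsert x T, r.Pairwise (· ≤ ·) := by
  induction T with
  | nil => intro x _; simp [tableauInsert]
  | cons r T ih =>
    intro x hT
    have hr : r.Pairwise (· ≤ ·) := hT r (by simp)
    have hT' : ∀ r ∈ T, r.Pairwise (· ≤ ·) := fun r h => hT r (by simp [h])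
    rw [tableauInsert]
    cases (rowInsert x r).2 with
    | none =>
      simp only [List.mem_cons, forall_eq_or_imp]
      exact ⟨rowInsert_pairwise_le hr, hT'⟩
    | some y =>
      simp only [List.mem_cons, forall_eq_or_imp]
      exact ⟨rowInsert_pairwise_le hr, ih hT'⟩

/-- If `x` bumps `y` from the row `u y v`, the new reading word has `y` (inserted further up the
word) before `u x v`. Induction on the lower rows brings `y` next to `u`; then `y` moves right past
`u`, and `x` past `v`. -/
theorem HasMonotoneSubwords.of_tableauInsert {s : ℕ} {T : List (List α)} :
    ∀ {x : α} {B : List α}, (∀ r ∈ T, r.Pairwise (· ≤ ·)) →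
      HasMonotoneSubwords ι s (readingWord (tableauInsert x T) ++ B) →
      HasMonotoneSubwords ι s (readingWord T ++ x :: B) := by
  induction T with
  | nil => intro x B _ h; simpa [tableauInsert, readingWord] using h
  | cons r T ih =>
    intro x B hT h
    have hr : r.Pairwise (· ≤ ·) := hT r (by simp)
    have hT' : ∀ r ∈ T, r.Pairwise (· ≤ ·) := fun r h => hT r (by simp [h])
    rw [tableauInsert] at h
    rcases rowInsert_cases x r with ⟨h1, h2⟩ | ⟨u, y, v, rfl, h2, h3, h4⟩
    · simpa [h1, readingWord_cons] using h
    · simp only [h4, readingWord_cons, List.append_assoc] at h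
      have h5 := ih hT' h
      have h6 := HasMonotoneSubwords.move_left_past u (fun a ha => (h2 a ha).trans_lt h3)
        (by simpa using h5)
      have h7 := HasMonotoneSubwords.move_right_past v (A := readingWord T ++ u) h3
        (hr.sublist (List.sublist_append_right _ _)) (by simpa using h6)
      simpa [readingWord_cons] using h7

theorem insertionTableau_append_singleton (w : List α) (x : α) :
    insertionTableau (w ++ [x]) = tableauInsert x (insertionTableau w) := by
  simp [insertionTableau]

theorem insertionTableau_pairwise_le (w : List α) :
    ∀ r ∈ insertionTableau w, r.Pairwise (· ≤ ·) := by
  induction w using List.reverseRecOn with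
  | nil => simp [insertionTableau]
  | append_singleton w x ih =>
    rw [insertionTableau_append_singleton]
    exact tableauInsert_pairwise_le ih

theorem HasMonotoneSubwords.of_insertionTableau {s : ℕ} (w : List α) :
    ∀ {B : List α}, HasMonotoneSubwords ι s (readingWord (insertionTableau w) ++ B) →
      HasMonotoneSubwords ι s (w ++ B) := by
  induction w using List.reverseRecOn with
  | nil => intro B h; simpa [insertionTableau, readingWord] using h
  | append_singleton w x ih =>
    intro B h
    rw [insertionTableau_append_singleton] at h
    simpa using ih (h.of_tableauInsert (insertionTableau_pairwise_le w))

theorem hasMonotoneSubwords_readingWord {S T : List (List α)} (hST : S.Sublist T)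
    (hT : ∀ r ∈ T, r.Pairwise (· ≤ ·)) :
    HasMonotoneSubwords (Fin S.length) (S.map List.length).sum (readingWord T) := by
  induction hST with
  | slnil => exact ⟨[], by simp [readingWord, IsMonotoneColoring]⟩
  | cons r _ ih =>
    obtain ⟨L, h1, h2, h3⟩ := ih fun r h => hT r (by simp [h])
    refine ⟨L ++ r.map fun a => (a, none), ?_, ?_, ?_⟩
    · simp [readingWord_cons, h1, Function.comp_def]
    · simpa [IsMonotoneColoring, List.pairwise_append, List.pairwise_map, List.pairwise_of_forall]
        using h2
    · simp [h3, List.countP_map, Function.comp_def]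
  | cons_cons r _ ih =>
    obtain ⟨L, h1, h2, h3⟩ := ih fun r h => hT r (by simp [h])
    refine ⟨L.map (Prod.map id (Option.map Fin.succ)) ++ r.map fun a => (a, some 0), ?_, ?_, ?_⟩
    · simp [readingWord_cons, h1, Function.comp_def]
    · simp only [IsMonotoneColoring, List.pairwise_append, List.pairwise_map, List.forall_mem_map]
      refine ⟨h2.imp ?_, ?_, ?_⟩
      · intro a b hab c ha hb
        simp only [Prod.map_snd, Option.map_eq_some_iff] at ha hb
        obtain ⟨a', ha, rfl⟩ := ha
        obtain ⟨b', hb, hab'⟩ := hb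
        rw [Fin.succ_inj.1 hab'] at hb
        exact hab _ ha hb
      · exact (hT r (by simp)).imp fun h _ _ _ => h
      · intro a _ b _ c ha hb
        simp only [Prod.map_snd, Option.map_eq_some_iff, Option.some.injEq] at ha hb
        obtain ⟨a', -, rfl⟩ := ha
        exact absurd hb.symm (Fin.succ_ne_zero _)
    · simp [← h3, List.countP_map, Function.comp_def, add_comm]

end Greene

/-! ### Partial sums of partitions and Greene's inequality -/

theorem exists_perm_map_eq_sort {β : Type*} (f : β → ℕ) (l : List β) :
    ∃ l' : List β, l'.Perm l ∧ l'.map f = Multiset.sort (l.map f : Multiset ℕ) (· ≥ ·) := by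
  refine ⟨l.mergeSort fun a b => decide (f b ≤ f a), List.mergeSort_perm _ _, ?_⟩
  refine List.Perm.eq_of_pairwise' (r := (· ≥ ·)) ?_ (Multiset.pairwise_sort _ _) ?_
  · rw [List.pairwise_map]
    refine (List.pairwise_mergeSort ?_ ?_ l).imp fun h => ?_
    · intro a b c h1 h2
      simp only [decide_eq_true_eq] at *
      omega
    · intro a b
      simp only [Bool.or_eq_true, decide_eq_true_eq]
      omega
    · simpa using h
  · rw [← Multiset.coe_eq_coe, Multiset.sort_eq]
    exact Multiset.coe_eq_coe.2 ((List.mergeSort_perm _ _).map f)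

theorem sum_le_sum_take_of_sublist {l : List ℕ} (hl : l.Pairwise (· ≥ ·)) :
    ∀ {l₀ : List ℕ} {k : ℕ}, l₀.Sublist l → l₀.length ≤ k → l₀.sum ≤ (l.take k).sum := by
  induction l with
  | nil => intro l₀ k h _; simp [List.sublist_nil.1 h]
  | cons a l ih =>
    intro l₀ k h hk
    cases l₀ with
    | nil => simp
    | cons c l₀ =>
      obtain ⟨k, rfl⟩ : ∃ k', k = k' + 1 := ⟨k - 1, by simp at hk; omega⟩
      rw [List.pairwise_cons] at hl
      have h1 : l₀.Sublist l := h.tail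
      have h2 : c ≤ a := by
        rcases List.mem_cons.1 (h.subset List.mem_cons_self) with rfl | hc
        · exact le_rfl
        · exact hl.1 c hc
      have h3 := ih hl.2 h1 (k := k) (by simpa using hk)
      simp only [List.take_succ_cons, List.sum_cons]
      omega

theorem sum_le_partialSum {n : ℕ} (μ : n.Partition) {M : Multiset ℕ} {k : ℕ} (hM : M ≤ μ.parts)
    (hk : M.card ≤ k) : M.sum ≤ partialSum μ k := by
  induction M using Quotient.inductionOn with
  | h l =>
  have h1 : l.Subperm (sortedParts μ) := by
    rw [← Multiset.coe_le]
    simpa [sortedParts] using hM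
  obtain ⟨l', hl', h2⟩ := h1
  have := sum_le_sum_take_of_sublist (Multiset.pairwise_sort μ.parts (· ≥ ·)) h2
    (k := k) (by simpa [hl'.length_eq] using hk)
  simpa [← hl'.sum_eq, partialSum, sortedParts] using this

theorem partialSum_mono {n : ℕ} (μ : n.Partition) : Monotone (partialSum μ) := fun _ _ h =>
  ((List.take_sublist_take_left h).sum_le_sum (by simp))

theorem partialSum_succ {n : ℕ} (μ : n.Partition) (r : ℕ) :
    partialSum μ (r + 1) = partialSum μ r + (sortedParts μ).getD r 0 := by
  simp only [partialSum]
  by_cases h : r < (sortedParts μ).length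
  · rw [List.sum_take_succ _ _ h, List.getD_eq_getElem _ _ h]
  · rw [List.getD_eq_default _ _ (by omega), List.take_of_length_le (by omega),
      List.take_of_length_le (by omega), add_zero]

theorem sum_sortedParts {n : ℕ} (μ : n.Partition) : (sortedParts μ).sum = n := by
  rw [← Multiset.sum_coe, sortedParts, Multiset.sort_eq, μ.parts_sum]

theorem partialSum_length {n : ℕ} (μ : n.Partition) :
    partialSum μ (sortedParts μ).length = n := by
  rw [partialSum, List.take_length, sum_sortedParts]

theorem partialSum_le {n : ℕ} (μ : n.Partition) (k : ℕ) : partialSum μ k ≤ n :=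
  ((List.take_sublist k _).sum_le_sum (by simp)).trans_eq (sum_sortedParts μ)

/-- The easy half of Greene's theorem, for the `k` longest rows of the insertion tableau. -/
theorem exists_hasMonotoneSubwords_shape {n : ℕ} (σ : Equiv.Perm (Fin n)) (k : ℕ) :
    ∃ m ≤ k, HasMonotoneSubwords (Fin m) (partialSum (shape σ) k) (List.ofFn σ) := by
  -- The rows are sorted by length here, so it need not be known that row lengths decrease down the
  -- tableau. `S` lists the `k` longest rows in tableau order, or all rows if there are fewer,
  -- whence `m ≤ k`.
  obtain ⟨T, hT, hmap⟩ := exists_perm_map_eq_sort List.length (insertionTableau (List.ofFn σ))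
  obtain ⟨S, hS, hsub⟩ := (List.take_sublist k T).subperm.trans hT.subperm
  have h := hasMonotoneSubwords_readingWord hsub (insertionTableau_pairwise_le _)
  refine ⟨S.length, by simp [hS.length_eq], ?_⟩
  have hs : (S.map List.length).sum = partialSum (shape σ) k := by
    rw [(hS.map _).sum_eq, List.map_take, hmap]
    rfl
  rw [hs] at h
  simpa using HasMonotoneSubwords.of_insertionTableau (List.ofFn σ) (B := []) (by simpa using h)

/-! ### Colourings of positions -/

theorem HasMonotoneSubwords.exists_coloring {α ι : Type*} [LinearOrder α] {n s : ℕ}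
    {σ : Fin n → α} (hinj : Function.Injective σ) (h : HasMonotoneSubwords ι s (List.ofFn σ)) :
    ∃ f : Fin n → Option ι, (∀ i j c, f i = some c → f j = some c → i < j → σ i < σ j) ∧
      (Finset.univ.filter fun i => (f i).isSome).card = s := by
  obtain ⟨L, h1, h2, h3⟩ := h
  have hlen : L.length = n := by simpa using congrArg List.length h1
  subst hlen
  have hσ : ∀ i : Fin L.length, (L.get i).1 = σ i := by
    intro i
    have := congrArg (fun l => l[(i : ℕ)]?) h1
    simpa using this
  refine ⟨fun i => (L.get i).2, fun i j c hi hj hij => ?_, ?_⟩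
  · have h4 := List.pairwise_iff_get.1 h2 i j hij c hi hj
    rw [hσ, hσ] at h4
    exact h4.lt_of_ne fun e => hij.ne (hinj e)
  · rw [← h3]
    conv_rhs => rw [← List.map_get_finRange L]
    rw [List.countP_map, List.countP_eq_length_filter, Finset.card_def, Finset.filter_val,
      Fin.univ_def, Multiset.filter_coe, Multiset.coe_card]
    congr 2
    funext i
    simp

/-! ### Stabilizers of colourings as conjugates of Young subgroups -/

theorem exists_perm_comp_eq {β κ : Type*} [Fintype β] [DecidableEq κ] (p q : β → κ)
    (h : ∀ r, (Finset.univ.filter fun i => p i = r).card =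
      (Finset.univ.filter fun i => q i = r).card) :
    ∃ g : Equiv.Perm β, ∀ i, p (g i) = q i := by
  have e : ∀ r, Nonempty ({i // q i = r} ≃ {i // p i = r}) := fun r =>
    ⟨Fintype.equivOfCardEq (by rw [Fintype.card_subtype, Fintype.card_subtype, h])⟩
  replace e := fun r => (e r).some
  refine ⟨(Equiv.sigmaFiberEquiv q).symm.trans
    ((Equiv.sigmaCongrRight e).trans (Equiv.sigmaFiberEquiv p)), fun i => ?_⟩
  exact (e (q i) ⟨i, rfl⟩).2

theorem mem_block {n : ℕ} {μ : n.Partition} {r : ℕ} {i : Fin n} :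
    i ∈ block μ r ↔ partialSum μ r ≤ (i : ℕ) ∧ (i : ℕ) < partialSum μ (r + 1) :=
  Iff.rfl

theorem exists_blockIndex {n : ℕ} (μ : n.Partition) :
    ∃ b : Fin n → ℕ, ∀ i r, i ∈ block μ r ↔ b i = r := by
  have hex : ∀ i : Fin n, ∃ r, (i : ℕ) < partialSum μ (r + 1) := fun i =>
    ⟨(sortedParts μ).length, i.2.trans_le <| (partialSum_length μ).symm.le.trans
      (partialSum_mono μ (Nat.le_succ _))⟩
  refine ⟨fun i => Nat.find (hex i), fun i r => ?_⟩
  rw [Nat.find_eq_iff]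
  refine ⟨fun h => ⟨h.2, fun m hm h' => ?_⟩, fun h => ⟨?_, h.1⟩⟩
  · exact absurd (h'.trans_le (partialSum_mono μ hm)) (not_lt.2 h.1)
  · cases r with
    | zero => simp [partialSum]
    | succ r => exact not_lt.1 (h.2 r (Nat.lt_succ_self r))

theorem card_block {n : ℕ} (μ : n.Partition) (r : ℕ) [DecidablePred (· ∈ block μ r)] :
    (Finset.univ.filter fun i => i ∈ block μ r).card = (sortedParts μ).getD r 0 := by
  rw [← Finset.card_map Fin.valEmbedding]
  have : (Finset.univ.filter fun i => i ∈ block μ r).map Fin.valEmbedding =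
      Finset.Ico (partialSum μ r) (partialSum μ (r + 1)) := by
    ext i
    simp only [Finset.mem_map, Finset.mem_filter_univ, Finset.mem_Ico, mem_block,
      Fin.valEmbedding_apply]
    refine ⟨?_, fun h => ⟨⟨i, h.2.trans_le (partialSum_le μ _)⟩, h, rfl⟩⟩
    rintro ⟨i, h, rfl⟩
    exact h
  rw [this, Nat.card_Ico, partialSum_succ]
  omega

theorem mem_youngSubgroup_iff {n : ℕ} {μ : n.Partition} {b : Fin n → ℕ}
    (hb : ∀ i r, i ∈ block μ r ↔ b i = r) (τ : Equiv.Perm (Fin n)) :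
    τ ∈ youngSubgroup μ ↔ ∀ i, b (τ i) = b i := by
  simp only [youngSubgroup, Subgroup.mem_iInf, MulAction.mem_stabilizer_iff]
  constructor
  · intro h i
    rw [← hb, ← h (b i)]
    exact Set.smul_mem_smul_set ((hb _ _).2 rfl)
  · intro h r
    ext i
    rw [Set.mem_smul_set_iff_inv_smul_mem, hb, hb, ← h]
    simp

/-- The permutations preserving the fibres of `f` form a conjugate of a Young subgroup, with `g`
carrying the consecutive blocks onto the fibres taken in order of decreasing size. -/
theorem exists_conj_youngSubgroup {n : ℕ} {κ : Type*} [DecidableEq κ] (f : Fin n → κ) :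
    ∃ (μ : n.Partition) (g : Equiv.Perm (Fin n)),
      μ.parts = (Finset.univ.image f).val.map
        (fun c => (Finset.univ.filter fun i => f i = c).card) ∧
      ∀ τ, τ ∈ youngSubgroup μ ↔ ∀ i, f ((g * τ * g⁻¹) i) = f i := by
  classical
  set size : κ → ℕ := fun c => (Finset.univ.filter fun i => f i = c).card with hsize
  let μ : n.Partition :=
    { parts := (Finset.univ.image f).val.map size
      parts_pos := by
        intro i hi
        obtain ⟨c, hc, rfl⟩ := Multiset.mem_map.1 hi
        obtain ⟨j, -, rfl⟩ := Finset.mem_image.1 (show c ∈ Finset.univ.image f from hc)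
        exact Finset.card_pos.2 ⟨j, by simp⟩
      parts_sum := by
        change ∑ c ∈ Finset.univ.image f, size c = n
        rw [← Finset.card_eq_sum_card_image, Finset.card_univ, Fintype.card_fin] }
  obtain ⟨cs, hcs, hmap⟩ := exists_perm_map_eq_sort size (Finset.univ.image f).toList
  have hsort : sortedParts μ = cs.map size := by
    rw [hmap, sortedParts, ← Multiset.map_coe, Finset.coe_toList]
  have hmem : ∀ i, f i ∈ cs := fun i => hcs.mem_iff.2 (by simp)
  have hnd : cs.Nodup := hcs.nodup_iff.2 (Finset.nodup_toList _)
  obtain ⟨b, hb⟩ := exists_blockIndex μ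
  -- The `r`-th block is matched with the fibre over the `r`-th entry of `cs`; beyond the end of
  -- `cs` both are empty, in accordance with the default value `0`.
  obtain ⟨g, hg⟩ := exists_perm_comp_eq (fun i => cs.idxOf (f i)) b (fun r => by
    simp only [← hb, card_block, hsort]
    by_cases hr : r < cs.length
    · rw [List.getD_eq_getElem _ _ (by simpa using hr), List.getElem_map, hsize]
      congr 1
      ext i
      simp only [Finset.mem_filter, Finset.mem_univ, true_and]
      constructor
      · rintro rfl
        simp
      · intro h
        rw [h, hnd.idxOf_getElem]
    · rw [List.getD_eq_default _ _ (by simpa using hr), Finset.card_eq_zero,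
        Finset.filter_eq_empty_iff]
      rintro i - rfl
      exact hr (List.idxOf_lt_length_iff.2 (hmem i)))
  refine ⟨μ, g, rfl, fun τ => ?_⟩
  have hfg : ∀ i j, f (g i) = f (g j) ↔ b i = b j := fun i j => by
    rw [← hg, ← hg, List.idxOf_inj (hmem _)]
  rw [mem_youngSubgroup_iff hb]
  constructor
  · intro h i
    have := (hfg (τ (g⁻¹ i)) (g⁻¹ i)).2 (h _)
    simpa using this
  · intro h i
    rw [← hfg]
    simpa using h (g i)

/-! ### Subgroup sums, colour classes and lexicographic minimality -/

theorem of_mul_setSum {R : Type*} [CommRing R] {G : Type*} [Group G] [Fintype G] (H : Set G)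
    [DecidablePred (· ∈ H)] (x : G) :
    MonoidAlgebra.of R G x * setSum R H = ∑ h : G with h ∈ H, MonoidAlgebra.of R G (x * h) := by
  rw [setSum, Finset.mul_sum]
  simp only [map_mul]
  exact Finset.sum_congr (by ext; simp) fun _ _ => rfl

theorem setSum_conj {R : Type*} [CommRing R] {G : Type*} [Group G] [Fintype G] (H K : Set G)
    (g : G) (h : ∀ τ, τ ∈ H ↔ g * τ * g⁻¹ ∈ K) :
    setSum R K = MonoidAlgebra.of R G g * setSum R H * MonoidAlgebra.of R G g⁻¹ := by
  classical
  rw [of_mul_setSum, Finset.sum_mul, setSum]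
  simp only [← map_mul]
  symm
  refine Finset.sum_bij (fun τ _ => g * τ * g⁻¹) ?_ ?_ ?_ ?_
  · intro τ hτ
    simpa [h] using hτ
  · intro a _ b _ hab
    simpa using hab
  · intro τ hτ
    exact ⟨g⁻¹ * τ * g, by simpa [h, mul_assoc] using hτ, by simp [mul_assoc]⟩
  · intro τ _
    rfl

/-- Letters of the same colour are identified, uncoloured positions are kept apart. -/
def classOf {n : ℕ} {ι : Type*} (f : Fin n → Option ι) (i : Fin n) : ι ⊕ Fin n :=
  (f i).elim (Sum.inr i) Sum.inl

theorem classOf_of_some {n : ℕ} {ι : Type*} {f : Fin n → Option ι} {i : Fin n} {c : ι}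
    (h : f i = some c) : classOf f i = Sum.inl c := by
  simp [classOf, h]

theorem classOf_of_none {n : ℕ} {ι : Type*} {f : Fin n → Option ι} {i : Fin n}
    (h : f i = none) : classOf f i = Sum.inr i := by
  simp [classOf, h]

theorem classOf_eq_inl {n : ℕ} {ι : Type*} {f : Fin n → Option ι} {i : Fin n} {c : ι} :
    classOf f i = Sum.inl c ↔ f i = some c := by
  cases h : f i with
  | none => simp [classOf_of_none h]
  | some d => simp [classOf_of_some h]

theorem eq_or_exists_of_classOf_eq {n : ℕ} {ι : Type*} {f : Fin n → Option ι} {i j : Fin n}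
    (h : classOf f i = classOf f j) : i = j ∨ ∃ c, f i = some c ∧ f j = some c := by
  cases hi : f i with
  | none =>
    left
    rw [classOf_of_none hi] at h
    cases hj : f j with
    | none => simpa [classOf_of_none hj] using h
    | some d => simp [classOf_of_some hj] at h
  | some c =>
    right
    rw [classOf_of_some hi, eq_comm, classOf_eq_inl] at h
    exact ⟨c, rfl, h⟩

/-- If `σ` is increasing on the classes of a colouring, it is lexicographically least in its coset
modulo the permutations preserving the classes. -/
theorem toLex_lt_toLex_mul {n : ℕ} {ι : Type*} {f : Fin n → Option ι} {σ τ : Equiv.Perm (Fin n)}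
    (hf : ∀ i j c, f i = some c → f j = some c → i < j → σ i < σ j)
    (hτ : ∀ i, classOf f (τ i) = classOf f i) (hne : τ ≠ 1) :
    toLex (σ : Fin n → Fin n) < toLex (⇑(σ * τ)) := by
  have hex : ∃ i, τ i ≠ i := by
    by_contra! h
    exact hne (Equiv.ext h)
  -- At the first moved position `i`, `τ i > i`, since all smaller positions are fixed; `i` and `τ
  -- i` share a colour, so `σ i < σ (τ i)`.
  obtain ⟨i, hi, hmin⟩ := WellFounded.has_min (wellFounded_lt (α := Fin n)) {i | τ i ≠ i} hex
  have hfix : ∀ j < i, τ j = j := fun j hj => by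
    by_contra h
    exact hmin j h hj
  refine ⟨i, fun j hj => ?_, ?_⟩
  · simp [hfix j hj]
  · obtain h | ⟨c, h1, h2⟩ := eq_or_exists_of_classOf_eq (hτ i)
    · exact absurd h hi
    · refine hf i (τ i) c h2 h1 ((lt_or_gt_of_ne hi).resolve_left fun hlt => ?_)
      exact hi (τ.injective (hfix _ hlt))

/-- The nonempty colour classes account for at most `m` of the parts of `μ`, so their total size is
at most the sum of the `m` largest parts. -/
theorem card_le_partialSum_of_parts_eq {n m : ℕ} {f : Fin n → Option (Fin m)} {μ : n.Partition}
    (hμ : μ.parts = (Finset.univ.image (classOf f)).val.map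
      (fun c => (Finset.univ.filter fun i => classOf f i = c).card)) :
    (Finset.univ.filter fun i => (f i).isSome).card ≤ partialSum μ m := by
  classical
  set C := (Finset.univ.image (classOf f)).filter fun c => c.isLeft with hC
  have hsub : C.val.map (fun c => (Finset.univ.filter fun i => classOf f i = c).card) ≤
      μ.parts := by
    rw [hμ]
    exact Multiset.map_le_map (Finset.val_le_iff.2 (Finset.filter_subset _ _))
  have hcard : C.card ≤ m := by
    have : C ⊆ Finset.univ.map (Function.Embedding.inl : Fin m ↪ Fin m ⊕ Fin n) := by
      rintro (c | c) hc
      · simp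
      · simp [hC] at hc
    simpa using Finset.card_le_card this
  refine le_trans (le_of_eq ?_) (sum_le_partialSum μ hsub (k := m) (by simpa using hcard))
  change _ = ∑ c ∈ C, _
  rw [Finset.card_eq_sum_card_fiberwise (f := classOf f) (t := C)]
  · refine Finset.sum_congr rfl fun c hc => ?_
    congr 1
    ext i
    simp only [Finset.mem_filter, Finset.mem_univ, true_and, and_iff_right_iff_imp]
    rintro rfl
    rw [hC, Finset.mem_filter] at hc
    cases h : f i with
    | none => simp [classOf_of_none h] at hc
    | some d => rfl
  · intro i hi
    obtain ⟨c, hc⟩ := Option.isSome_iff_exists.1 (Finset.mem_filter.1 hi).2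
    simp only [hC, Finset.coe_filter, Finset.mem_image, Finset.mem_univ, true_and,
      Set.mem_ofPred_eq]
    exact ⟨⟨i, rfl⟩, by simp [classOf_of_some hc]⟩

/-- If `Δ` contains every partition not dominated by `lam`, a permutation `σ` whose shape is not
dominated by `lam` is lexicographically least in `σ H` for some `H` with `[H] ∈ I_R(Δ)`. -/
theorem exists_setSum_mem_youngIdeal {R : Type*} [CommRing R] {n : ℕ} {Δ : Set n.Partition}
    {lam : n.Partition} (hΔ : ∀ μ, ¬ μ ≤ lam → μ ∈ Δ) {σ : Equiv.Perm (Fin n)}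
    (hσ : ¬ shape σ ≤ lam) :
    ∃ H : Set (Equiv.Perm (Fin n)), 1 ∈ H ∧ setSum R H ∈ youngIdeal R Δ ∧
      ∀ τ ∈ H, τ ≠ 1 → toLex (σ : Fin n → Fin n) < toLex (⇑(σ * τ)) := by
  classical
  obtain ⟨k, hk⟩ : ∃ k, partialSum lam k < partialSum (shape σ) k := by
    by_contra! h
    exact hσ h
  obtain ⟨m, hmk, hsub⟩ := exists_hasMonotoneSubwords_shape σ k
  obtain ⟨f, hf, hcard⟩ := hsub.exists_coloring σ.injective
  obtain ⟨μ, g, hμ, hg⟩ := exists_conj_youngSubgroup (classOf f)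
  refine ⟨{τ | ∀ i, classOf f (τ i) = classOf f i}, fun i => rfl, ?_,
    fun τ hτ hne => toLex_lt_toLex_mul hf hτ hne⟩
  rw [setSum_conj (youngSubgroup μ : Set (Equiv.Perm (Fin n)))
    {τ | ∀ i, classOf f (τ i) = classOf f i} g fun τ => hg τ]
  refine TwoSidedIdeal.mul_mem_right _ _ _ (TwoSidedIdeal.mul_mem_left _ _ _
    (TwoSidedIdeal.subset_span ⟨μ, hΔ μ fun hle => ?_, rfl⟩))
  -- If `μ ≤ lam`, the number of coloured positions, `partialSum (shape σ) k`, would be at most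
  -- `partialSum lam m ≤ partialSum lam k`, against the choice of `k`.
  have h1 := card_le_partialSum_of_parts_eq hμ
  have h2 := hle m
  have h3 := partialSum_mono lam hmk
  omega

end SymGroupAlg

/-! ### Lexicographic straightening -/

/-- "Co-saturated" is `IsUpperSet` for the dominance order. -/
theorem lemma2p5 (R : Type*) [CommRing R] (n : ℕ) (Δ : Set n.Partition)
    (hΔ : IsUpperSet Δ) (hmax : ∃! μ : n.Partition, Maximal (fun ν => ν ∈ Δᶜ) μ) :
    (⊤ : Submodule R (MonoidAlgebra R (Equiv.Perm (Fin n)))) =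
      SymGroupAlg.setSpan R (SymGroupAlg.permsOfShape Δᶜ) ⊔
        (SymGroupAlg.youngIdeal R Δ).asIdeal.restrictScalars R := by
  classical
  obtain ⟨lam, hlam, huniq⟩ := hmax
  have hle : ∀ μ, ¬ μ ≤ lam → μ ∈ Δ := fun μ h => by
    by_contra hμ
    obtain ⟨ν, hμν, hν⟩ := Finite.exists_le_maximal (p := fun ν => ν ∈ Δᶜ) hμ
    exact h (huniq ν hν ▸ hμν)
  set M := SymGroupAlg.setSpan R (SymGroupAlg.permsOfShape Δᶜ) ⊔
        (SymGroupAlg.youngIdeal R Δ).asIdeal.restrictScalars R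
  have key : ∀ (w : Lex (Fin n → Fin n)) (σ : Equiv.Perm (Fin n)), toLex (σ : Fin n → Fin n) = w →
      MonoidAlgebra.of R _ σ ∈ M := by
    intro w
    induction w using WellFoundedGT.induction with
    | ind w ih =>
    rintro σ rfl
    by_cases hσ : SymGroupAlg.shape σ ∈ Δ
    · obtain ⟨H, h1, hH, hlt⟩ := SymGroupAlg.exists_setSum_mem_youngIdeal (R := R) hle
        (σ := σ) fun h => hlam.1 (hΔ h hσ)
      have hmem : MonoidAlgebra.of R _ σ * SymGroupAlg.setSum R H ∈ M :=
        Submodule.mem_sup_right (TwoSidedIdeal.mul_mem_left _ _ _ hH)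
      -- The term of `1 ∈ H` is `σ` itself; all others are lexicographically larger, hence in `M` by
      -- induction.
      rw [SymGroupAlg.of_mul_setSum, ← Finset.add_sum_erase _ _
        (Finset.mem_filter.2 ⟨Finset.mem_univ 1, h1⟩), mul_one] at hmem
      refine (Submodule.add_mem_iff_left M (Submodule.sum_mem _ fun τ hτ => ?_)).1 hmem
      simp only [Finset.mem_erase, Finset.mem_filter] at hτ
      exact ih _ (hlt τ hτ.2.2 hτ.1) _ rfl
    · exact Submodule.mem_sup_left (Submodule.subset_span ⟨σ, hσ, rfl⟩)
  refine (eq_top_iff.2 fun x _ => ?_).symm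
  induction x using MonoidAlgebra.induction_on with
  | of σ => exact key _ σ rfl
  | add x y hx hy => exact M.add_mem (hx trivial) (hy trivial)
  | smul r x hx => exact M.smul_mem r (hx trivial)
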